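/- Let $X$ be a topological space. For $A,B\subseteq X$ write $A\approx B$ if $A\setminus B$ and $B\setminus A$ are meager, and let $\wp(X)/\mathbf M$ be the Boolean algebra of classes $[A]$, with the operations induced by those of $\wp(X)$; thus $[A]\le[B]$ iff $A\setminus B$ is meager. An element is closed if it equals $[C]$ for some closed $C\subseteq X$. Above every element $a$ there is a least closed element $\mathbf c a$, and $\mathrm{Baire}(X)=(\wp(X)/\mathbf M,\mathbf c)$ is a closure algebra: $a\le\mathbf c a$, $\mathbf c\mathbf c a\le\mathbf c a$, $\mathbf c(a\vee b)=\mathbf c a\vee\mathbf c b$, $\mathbf c 0=0$. Modal formulas over a set $P$ of variables are built from $P$ by $\wedge,\neg,\Diamond$, with $\varphi\vee\psi:=\neg(\neg\varphi\wedge\neg\psi)$, $\varphi\to\psi:=\neg(\varphi\wedge\neg\psi)$ and $\Box\varphi:=\neg\Diamond\neg\varphi$. The logic $\mathsf{S5}^P$ is the least set of formulas that contains all classical propositional tautologies and all instances of $\Diamond(\varphi\vee\psi)\to\Diamond\varphi\vee\Diamond\psi$, $\varphi\to\Diamond\varphi$, $\Diamond\Diamond\varphi\to\Diamond\varphi$,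 $\neg\Diamond(\varphi\wedge\neg\varphi)$ and $\Diamond\varphi\to\Box\Diamond\varphi$, and is closed under substitution, modus ponens and the rule (Mon): from $\varphi\to\psi$ infer $\Diamond\varphi\to\Diamond\psi$. For a set $\Gamma$ of formulas, $\Gamma\vdash_{\mathsf{S5}^P}\varphi$ means that $\varphi$ belongs to the least set that contains $\Gamma$ and $\mathsf{S5}^P$ and is closed under modus ponens and (Mon). A valuation $v\colon P\to B$ in a closure algebra $B$ extends to all formulas by interpreting $\wedge,\neg$ as meet and complement and $\Diamond$ as $\mathbf c$; a formula is valid under $v$ if its value is $1$. The logic of $B$ (over $P$) is the set of formulas valid under all valuations in $B$. $\mathsf{S5}^P$ is sound for $B$ if it is contained in the logic of $B$ over $P$. It is strongly complete for $B$ if, for all $\Gamma$ and $\varphi$, $\Gamma\vdash_{\mathsf{S5}^P}\varphi$ holds whenever every valuation in $B$ under which all members of $\Gamma$ are valid also makes $\varphi$ valid. **Theorem.** Let $X$ be a nonempty topological space without isolated points which is either completely metrizable and of cardinality $\mathfrak c=2^{\aleph_0}$, or second-countable locally compact Hausdorff. Then, for every set $P$ of $\mathfrak c$ many variables, $\mathsf{S5}^P$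 is sound and strongly complete for $\mathrm{Baire}(X)$. In particular $\mathsf{S5}$ (over the countable set of variables $P=\mathbb N$) is the logic of $\mathrm{Baire}(X)$ whenever $X$ is 1. $\mathbb R^n$ for some $n\ge1$; 2. a nonempty perfect closed subset of $\mathbb R^n$; in particular, the Cantor space $\{0,1\}^{\mathbb N}$ or the interval $[0,1]$; 3. the (real or complex) Banach space $\ell^p$ for some $p\in[1,\infty]$. -/

import Mathlib

open Set Topology

namespace BaireLogic

universe u v w

/-! ## Closure algebras -/

/-- A closure algebra: a Boolean algebra with an operator `c` satisfying the Kuratowski axioms. -/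
class ClosureAlgebra (B : Type u) extends BooleanAlgebra B where
  /-- the closure operator -/
  c : B → B
  le_c : ∀ a : B, a ≤ c a
  c_c_le : ∀ a : B, c (c a) ≤ c a
  c_sup : ∀ a b : B, c (a ⊔ b) = c a ⊔ c b
  c_bot : c ⊥ = ⊥

/-! ## The Baire algebra of a topological space -/

section Baire

variable (X : Type u) [TopologicalSpace X]

/-- Equality of subsets of `X` modulo meager sets. -/
def meagerSetoid : Setoid (Set X) where
  r A B := IsMeagre (A \ B) ∧ IsMeagre (B \ A)
  iseqv :=
    { refl := fun A => by simp [IsMeagre.empty]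
      symm := fun h => ⟨h.2, h.1⟩
      trans := fun {A B C} h k =>
        ⟨(h.1.union k.1).mono (fun x hx => by
            by_cases hB : x ∈ B
            · exact Or.inr ⟨hB, hx.2⟩
            · exact Or.inl ⟨hx.1, hB⟩),
          (h.2.union k.2).mono (fun x hx => by
            by_cases hB : x ∈ B
            · exact Or.inl ⟨hB, hx.2⟩
            · exact Or.inr ⟨hx.1, hB⟩)⟩ }

/-- The quotient of the powerset of `X` by the ideal of meager sets. -/
def BaireAlgebra : Type u := Quotient (meagerSetoid X)

variable {X}

/-- The class of the set `A` modulo meager sets. -/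
def BaireAlgebra.mk (A : Set X) : BaireAlgebra X := Quotient.mk (meagerSetoid X) A

theorem BaireAlgebra.ind {p : BaireAlgebra X → Prop} (h : ∀ A : Set X, p (BaireAlgebra.mk A))
    (a : BaireAlgebra X) : p a := Quotient.ind h a

theorem BaireAlgebra.mk_eq_mk {A B : Set X} :
    BaireAlgebra.mk A = BaireAlgebra.mk B ↔ IsMeagre (A \ B) ∧ IsMeagre (B \ A) :=
  Quotient.eq (r := meagerSetoid X)

theorem isMeagre_diff_trans {A B C : Set X} (h : IsMeagre (A \ B)) (k : IsMeagre (B \ C)) :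
    IsMeagre (A \ C) :=
  (h.union k).mono (fun x hx => by
    by_cases hB : x ∈ B
    · exact Or.inr ⟨hB, hx.2⟩
    · exact Or.inl ⟨hx.1, hB⟩)

instance : LE (BaireAlgebra X) where
  le := Quotient.lift₂ (s₁ := meagerSetoid X) (s₂ := meagerSetoid X)
    (fun A B => IsMeagre (A \ B)) (fun _ _ _ _ h k => propext
      ⟨fun hm => isMeagre_diff_trans h.2 (isMeagre_diff_trans hm k.1),
        fun hm => isMeagre_diff_trans h.1 (isMeagre_diff_trans hm k.2)⟩)

theorem BaireAlgebra.mk_le_mk {A B : Set X} :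
    BaireAlgebra.mk A ≤ BaireAlgebra.mk B ↔ IsMeagre (A \ B) := Iff.rfl

/-- The Boolean operations are induced by those of the powerset. -/
instance : BooleanAlgebra (BaireAlgebra X) where
  le_refl a := by
    induction a using BaireAlgebra.ind with | h A =>
    rw [BaireAlgebra.mk_le_mk]; simp [IsMeagre.empty]
  le_trans a b c := by
    induction a using BaireAlgebra.ind with | h A =>
    induction b using BaireAlgebra.ind with | h B =>
    induction c using BaireAlgebra.ind with | h C =>
    exact isMeagre_diff_trans
  le_antisymm a b := by
    induction a using BaireAlgebra.ind with | h A =>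
    induction b using BaireAlgebra.ind with | h B =>
    exact fun h k => BaireAlgebra.mk_eq_mk.2 ⟨h, k⟩
  sup := Quotient.map₂ (sa := meagerSetoid X) (sb := meagerSetoid X) (sc := meagerSetoid X)
    (fun A B => A ∪ B) (fun _ _ h _ _ k =>
      ⟨(h.1.union k.1).mono (by grind), (h.2.union k.2).mono (by grind)⟩)
  inf := Quotient.map₂ (sa := meagerSetoid X) (sb := meagerSetoid X) (sc := meagerSetoid X)
    (fun A B => A ∩ B) (fun _ _ h _ _ k =>
      ⟨(h.1.union k.1).mono (by grind), (h.2.union k.2).mono (by grind)⟩)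
  compl := Quotient.map (sa := meagerSetoid X) (sb := meagerSetoid X)
    (fun A => Aᶜ) (fun _ _ h => ⟨h.2.mono (by grind), h.1.mono (by grind)⟩)
  top := BaireAlgebra.mk univ
  bot := BaireAlgebra.mk ∅
  le_sup_left a b := by
    induction a using BaireAlgebra.ind with | h A =>
    induction b using BaireAlgebra.ind with | h B =>
    exact IsMeagre.empty.mono (fun x hx => hx.2 (Or.inl hx.1))
  le_sup_right a b := by
    induction a using BaireAlgebra.ind with | h A =>
    induction b using BaireAlgebra.ind with | h B =>
    exact IsMeagre.empty.mono (fun x hx => hx.2 (Or.inr hx.1))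
  sup_le a b c := by
    induction a using BaireAlgebra.ind with | h A =>
    induction b using BaireAlgebra.ind with | h B =>
    induction c using BaireAlgebra.ind with | h C =>
    exact fun h k => (IsMeagre.union h k).mono (fun x hx =>
      hx.1.elim (fun hA => Or.inl ⟨hA, hx.2⟩) (fun hB => Or.inr ⟨hB, hx.2⟩))
  inf_le_left a b := by
    induction a using BaireAlgebra.ind with | h A =>
    induction b using BaireAlgebra.ind with | h B =>
    exact IsMeagre.empty.mono (fun x hx => hx.2 hx.1.1)
  inf_le_right a b := by
    induction a using BaireAlgebra.ind with | h A =>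
    induction b using BaireAlgebra.ind with | h B =>
    exact IsMeagre.empty.mono (fun x hx => hx.2 hx.1.2)
  le_inf a b c := by
    induction a using BaireAlgebra.ind with | h A =>
    induction b using BaireAlgebra.ind with | h B =>
    induction c using BaireAlgebra.ind with | h C =>
    exact fun h k => (IsMeagre.union h k).mono (fun x hx => by
      by_cases hB : x ∈ B
      · exact Or.inr ⟨hx.1, fun hC => hx.2 ⟨hB, hC⟩⟩
      · exact Or.inl ⟨hx.1, hB⟩)
  le_sup_inf a b c := by
    induction a using BaireAlgebra.ind with | h A =>
    induction b using BaireAlgebra.ind with | h B =>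
    induction c using BaireAlgebra.ind with | h C =>
    exact IsMeagre.empty.mono (fun x hx => hx.2 (by
      rcases hx.1 with ⟨h1 | h1, h2 | h2⟩
      · exact Or.inl h1
      · exact Or.inl h1
      · exact Or.inl h2
      · exact Or.inr ⟨h1, h2⟩))
  inf_compl_le_bot a := by
    induction a using BaireAlgebra.ind with | h A =>
    exact IsMeagre.empty.mono (fun x hx => hx.1.2 hx.1.1)
  top_le_sup_compl a := by
    induction a using BaireAlgebra.ind with | h A =>
    exact IsMeagre.empty.mono (fun x hx => hx.2 (Classical.em (x ∈ A)))
  le_top a := by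
    induction a using BaireAlgebra.ind with | h A =>
    exact IsMeagre.empty.mono (fun x hx => hx.2 trivial)
  bot_le a := by
    induction a using BaireAlgebra.ind with | h A =>
    exact IsMeagre.empty.mono (fun x hx => hx.1)

theorem BaireAlgebra.mk_sup_mk (A B : Set X) :
    BaireAlgebra.mk A ⊔ BaireAlgebra.mk B = BaireAlgebra.mk (A ∪ B) := rfl

theorem BaireAlgebra.mk_inf_mk (A B : Set X) :
    BaireAlgebra.mk A ⊓ BaireAlgebra.mk B = BaireAlgebra.mk (A ∩ B) := rfl

theorem BaireAlgebra.compl_mk (A : Set X) :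
    (BaireAlgebra.mk A)ᶜ = BaireAlgebra.mk Aᶜ := rfl

theorem BaireAlgebra.top_def : (⊤ : BaireAlgebra X) = BaireAlgebra.mk univ := rfl

theorem BaireAlgebra.bot_def : (⊥ : BaireAlgebra X) = BaireAlgebra.mk ∅ := rfl

/-- An element of the Baire algebra is closed if it is the class of a closed set. -/
def BaireAlgebra.IsClosedElem (a : BaireAlgebra X) : Prop :=
  ∃ C : Set X, IsClosed C ∧ a = BaireAlgebra.mk C

/-- A relative form of the Banach category theorem: if `A` is meager in each member of a family
of open sets, then `A` is meager in their union. -/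
theorem isMeagre_inter_sUnion (A : Set X) (O : Set (Set X)) (hO : ∀ U ∈ O, IsOpen U)
    (hA : ∀ U ∈ O, IsMeagre (A ∩ U)) : IsMeagre (A ∩ ⋃₀ O) := by
  classical
  -- a maximal disjoint family of open sets refining `O`
  obtain ⟨F, hF⟩ := zorn_subset
    {F : Set (Set X) | (∀ V ∈ F, IsOpen V ∧ ∃ U ∈ O, V ⊆ U) ∧ F.PairwiseDisjoint id} (by
      intro c hc hchain
      refine ⟨⋃₀ c, ⟨?_, ?_⟩, fun s hs => subset_sUnion_of_mem hs⟩
      · rintro V ⟨F, hF, hV⟩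
        exact (hc hF).1 V hV
      · exact (pairwiseDisjoint_sUnion hchain.directedOn).2 fun F hF => (hc hF).2)
  have hFO := hF.prop.1
  have hdisj := hF.prop.2
  have hmax : ∀ W : Set X, IsOpen W → (∃ U ∈ O, W ⊆ U) → (∀ V ∈ F, Disjoint W V) → W ∈ F := by
    intro W hW hU hd
    have hins : insert W F ∈ {F : Set (Set X) | (∀ V ∈ F, IsOpen V ∧ ∃ U ∈ O, V ⊆ U) ∧
        F.PairwiseDisjoint id} := by
      refine ⟨?_, ?_⟩
      · rintro V (rfl | hV)
        · exact ⟨hW, hU⟩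
        · exact hFO V hV
      · exact hdisj.insert fun V hV _ => hd V hV
    exact hF.le_of_ge hins (subset_insert W F) (mem_insert W F)
  -- `⋃₀ O` is contained in the closure of `⋃₀ F`
  have hsub : ⋃₀ O ⊆ closure (⋃₀ F) := by
    rintro x ⟨U, hU, hxU⟩
    by_contra hx
    have hmem : U \ closure (⋃₀ F) ∈ F := by
      refine hmax _ ((hO U hU).sdiff isClosed_closure) ⟨U, hU, sdiff_subset⟩ ?_
      intro V hV
      rw [Set.disjoint_left]
      exact fun y hy hyV => hy.2 (subset_closure ⟨V, hV, hyV⟩)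
    exact hx (subset_closure ⟨_, hmem, hxU, hx⟩)
  have hFopen : IsOpen (⋃₀ F) := isOpen_sUnion fun V hV => (hFO V hV).1
  -- the boundary of `⋃₀ F` is nowhere dense
  have hbd : IsMeagre (closure (⋃₀ F) \ ⋃₀ F) := by
    refine IsNowhereDense.isMeagre ?_
    rw [← hFopen.frontier_eq, isClosed_frontier.isNowhereDense_iff]
    rw [← frontier_compl]; exact interior_frontier hFopen.isClosed_compl
  -- each `A ∩ V` is a countable union of nowhere dense sets
  have hN : ∀ V ∈ F, ∃ N : ℕ → Set X, (∀ n, IsNowhereDense (N n)) ∧ A ∩ V ⊆ ⋃ n, N n := by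
    intro V hV
    obtain ⟨U, hU, hVU⟩ := (hFO V hV).2
    have hm : IsMeagre (A ∩ V) := (hA U hU).mono (inter_subset_inter_right A hVU)
    obtain ⟨S, hS, hc, hcov⟩ := isMeagre_iff_countable_union_isNowhereDense.1 hm
    obtain ⟨f, hf⟩ := (hc.insert ∅).exists_eq_range (insert_nonempty ∅ S)
    refine ⟨f, fun n => ?_, fun x hx => ?_⟩
    · have : f n ∈ insert ∅ S := hf ▸ mem_range_self n
      rcases this with h | h
      · rw [h]; exact isNowhereDense_empty
      · exact hS _ h
    · obtain ⟨t, ht, hxt⟩ := hcov hx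
      have : t ∈ range f := hf ▸ mem_insert_of_mem _ ht
      obtain ⟨n, rfl⟩ := this
      exact mem_iUnion.2 ⟨n, hxt⟩
  choose! N hNd hNc using hN
  have hM : ∀ n, IsNowhereDense (⋃ V ∈ F, (N V n ∩ V)) := by
    intro n
    rw [isNowhereDense_iff_forall_notMem_nhds]
    intro x hx hcl
    simp only [mem_iUnion] at hx
    obtain ⟨V, hV, hxN, hxV⟩ := hx
    have hVo := (hFO V hV).1
    have key : closure (⋃ V ∈ F, (N V n ∩ V)) ∩ V ⊆ closure (N V n) := by
      rintro y ⟨hy, hyV⟩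
      have := hVo.closure_inter ⟨hy, hyV⟩
      refine closure_mono ?_ this
      rintro z ⟨hz, hzV⟩
      simp only [mem_iUnion] at hz
      obtain ⟨V', hV', hzN, hzV'⟩ := hz
      have : V' = V := hdisj.elim_set hV' hV z hzV' hzV
      exact this ▸ hzN
    exact isNowhereDense_iff_forall_notMem_nhds.1 (hNd V hV n) x hxN
      (Filter.mem_of_superset (Filter.inter_mem hcl (hVo.mem_nhds hxV)) key)
  refine ((isMeagre_iUnion fun n => (hM n).isMeagre).union hbd).mono ?_
  rintro x ⟨hxA, hxO⟩
  by_cases hx : x ∈ ⋃₀ F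
  · obtain ⟨V, hV, hxV⟩ := hx
    obtain ⟨n, hn⟩ := mem_iUnion.1 (hNc V hV ⟨hxA, hxV⟩)
    exact Or.inl (mem_iUnion.2 ⟨n, mem_iUnion₂.2 ⟨V, hV, hn, hxV⟩⟩)
  · exact Or.inr ⟨hsub hxO, hx⟩

/-- Above every element of the Baire algebra there is a least closed one. -/
theorem BaireAlgebra.exists_isLeast_closed (a : BaireAlgebra X) :
    ∃ b, IsLeast {b : BaireAlgebra X | b.IsClosedElem ∧ a ≤ b} b := by
  induction a using BaireAlgebra.ind with | h A =>
  refine ⟨BaireAlgebra.mk (⋂₀ {C : Set X | IsClosed C ∧ IsMeagre (A \ C)}),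
    ⟨⟨_, isClosed_sInter fun C hC => hC.1, rfl⟩, ?_⟩, ?_⟩
  · rw [BaireAlgebra.mk_le_mk]
    refine (isMeagre_inter_sUnion A {U : Set X | IsOpen U ∧ IsMeagre (A ∩ U)}
      (fun U hU => hU.1) (fun U hU => hU.2)).mono ?_
    rintro x ⟨hxA, hx⟩
    simp only [mem_sInter, not_forall] at hx
    obtain ⟨C, hC, hxC⟩ := hx
    exact ⟨hxA, Cᶜ, ⟨hC.1.isOpen_compl, by rw [← sdiff_eq]; exact hC.2⟩, hxC⟩
  · rintro _ ⟨⟨C, hC, rfl⟩, hle⟩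
    exact IsMeagre.empty.mono fun x hx => hx.2 (hx.1 C ⟨hC, hle⟩)

/-- The closure of `a` in the Baire algebra: the least closed element above `a`. -/
noncomputable def BaireAlgebra.cl (a : BaireAlgebra X) : BaireAlgebra X :=
  Classical.choose a.exists_isLeast_closed

theorem BaireAlgebra.isLeast_cl (a : BaireAlgebra X) :
    IsLeast {b : BaireAlgebra X | b.IsClosedElem ∧ a ≤ b} a.cl :=
  Classical.choose_spec a.exists_isLeast_closed

/-- The Baire algebra of an arbitrary topological space is a closure algebra. -/
noncomputable instance : ClosureAlgebra (BaireAlgebra X) where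
  c := BaireAlgebra.cl
  le_c a := a.isLeast_cl.1.2
  c_c_le a := a.cl.isLeast_cl.2 ⟨a.isLeast_cl.1.1, le_rfl⟩
  c_sup a b := by
    apply le_antisymm
    · refine (a ⊔ b).isLeast_cl.2 ⟨?_, sup_le_sup a.isLeast_cl.1.2 b.isLeast_cl.1.2⟩
      obtain ⟨C, hC, hCa⟩ := a.isLeast_cl.1.1
      obtain ⟨D, hD, hDb⟩ := b.isLeast_cl.1.1
      exact ⟨C ∪ D, hC.union hD, by rw [hCa, hDb]; rfl⟩
    · have h := (a ⊔ b).isLeast_cl.1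
      exact sup_le (a.isLeast_cl.2 ⟨h.1, le_sup_left.trans h.2⟩)
        (b.isLeast_cl.2 ⟨h.1, le_sup_right.trans h.2⟩)
  c_bot := le_antisymm
    ((⊥ : BaireAlgebra X).isLeast_cl.2 ⟨⟨∅, isClosed_empty, rfl⟩, le_rfl⟩) bot_le

end Baire

/-! ## Modal logic -/

/-- Formulas of the basic unimodal language with propositional variables in `P`. -/
inductive Formula (P : Type w) : Type w
  | var : P → Formula P
  | and : Formula P → Formula P → Formula P
  | neg : Formula P → Formula P
  | dia : Formula P → Formula P

namespace Formula

variable {P : Type w}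

/-- Disjunction. -/
def or (φ ψ : Formula P) : Formula P := neg (and (neg φ) (neg ψ))

/-- Implication. -/
def imp (φ ψ : Formula P) : Formula P := neg (and φ (neg ψ))

/-- The modality `□`. -/
def box (φ : Formula P) : Formula P := neg (dia (neg φ))

/-- Uniform substitution of formulas for variables. -/
def subst (σ : P → Formula P) : Formula P → Formula P
  | var p => σ p
  | and φ ψ => and (subst σ φ) (subst σ ψ)
  | neg φ => neg (subst σ φ)
  | dia φ => dia (subst σ φ)

/-- Classical propositional tautologies, where variables and formulas `◇ψ` count as atoms. -/
def IsTautology (φ : Formula P) : Prop :=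
  ∀ t : Formula P → Prop,
    (∀ ψ χ, t (and ψ χ) ↔ t ψ ∧ t χ) → (∀ ψ, t (neg ψ) ↔ ¬ t ψ) → t φ

/-- The valuation of formulas in a closure algebra extending `v`. -/
def val {B : Type v} [ClosureAlgebra B] (v : P → B) : Formula P → B
  | var p => v p
  | and φ ψ => val v φ ⊓ val v ψ
  | neg φ => (val v φ)ᶜ
  | dia φ => ClosureAlgebra.c (val v φ)

end Formula

open Formula

variable {P : Type w}

/-- The theorems of `S5` in the language with variables `P`: the axioms are given as schemes. -/
inductive S5Theorem : Formula P → Prop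
  | taut {φ : Formula P} : IsTautology φ → S5Theorem φ
  | axM (φ ψ : Formula P) : S5Theorem (imp (dia (or φ ψ)) (or (dia φ) (dia ψ)))
  | axT (φ : Formula P) : S5Theorem (imp φ (dia φ))
  | ax4 (φ : Formula P) : S5Theorem (imp (dia (dia φ)) (dia φ))
  | axN (φ : Formula P) : S5Theorem (neg (dia (and φ (neg φ))))
  | ax5 (φ : Formula P) : S5Theorem (imp (dia φ) (box (dia φ)))
  | sub {φ : Formula P} (σ : P → Formula P) : S5Theorem φ → S5Theorem (subst σ φ)
  | mp {φ ψ : Formula P} : S5Theorem φ → S5Theorem (imp φ ψ) → S5Theorem ψ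
  | mon {φ ψ : Formula P} : S5Theorem (imp φ ψ) → S5Theorem (imp (dia φ) (dia ψ))

/-- The logic `S5` in the language with variables `P`, as a set of formulas. -/
def S5 (P : Type w) : Set (Formula P) := {φ | S5Theorem φ}

/-- `Derivable L Γ φ`: the formula `φ` is derivable from premises `Γ` in the logic `L`
(global derivability: modus ponens and monotonicity apply to the premises and what is derived
from them, while the substitution rule is applied only to theorems of `L`). -/
inductive Derivable (L Γ : Set (Formula P)) : Formula P → Prop
  | prem {φ : Formula P} : φ ∈ Γ → Derivable L Γ φ
  | thm {φ : Formula P} : φ ∈ L → Derivable L Γ φ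
  | mp {φ ψ : Formula P} : Derivable L Γ φ → Derivable L Γ (imp φ ψ) → Derivable L Γ ψ
  | mon {φ ψ : Formula P} : Derivable L Γ (imp φ ψ) → Derivable L Γ (imp (dia φ) (dia ψ))

variable (P) in
/-- The logic of a closure algebra: the set of formulas valid under all valuations. -/
def Log (B : Type v) [ClosureAlgebra B] : Set (Formula P) :=
  {φ | ∀ v : P → B, val v φ = ⊤}

/-- Global consequence over `B`: each valuation that makes all of `Γ` valid makes `φ` valid. -/
def Consequence (B : Type v) [ClosureAlgebra B] (Γ : Set (Formula P)) (φ : Formula P) : Prop :=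
  ∀ v : P → B, (∀ γ ∈ Γ, val v γ = ⊤) → val v φ = ⊤

/-- Soundness of a logic for a closure algebra. -/
def Sound (L : Set (Formula P)) (B : Type v) [ClosureAlgebra B] : Prop :=
  L ⊆ Log P B

/-- Strong completeness of a logic for a closure algebra. -/
def StronglyComplete (L : Set (Formula P)) (B : Type v) [ClosureAlgebra B] : Prop :=
  ∀ (Γ : Set (Formula P)) (φ : Formula P), Consequence B Γ φ → Derivable L Γ φ

end BaireLogic

/-! Soundness holds for every space. The complement of a closed set `C` differs from its closure
only by the nowhere dense frontier of `C`, so complements of closed elements are closed, which is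
what axiom 5 demands.

For completeness, suppose `φ` is not derivable from `Γ`. Lindenbaum's lemma gives a world `t`
omitting `φ`, and for each `ψ` with `◇ψ` in `t` a world `w ψ` that contains `ψ` and has the same
`◇`-formulas as `t` (`IsWorld.exists_world`). Let `J` be the set of these `ψ`. If `f : X → J` has
fibres that are nonmeager in every nonempty open set, let a variable denote the set of points `x` at
which `w (f x)` contains it. By induction the same description holds for all formulas: if `◇α` is in
`t`, the set for `α` contains the fibre over `α`, so its closure is `⊤`; otherwise `α` is in no `w
ψ` and its set is empty. All of `Γ` is then valid, while `¬φ` holds on a nonmeager fibre.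

Such a partition comes from Bernstein's construction. If `#X ≤ 𝔠`, there are at most `𝔠` Cantor sets
in `X`, and transfinite recursion splits `X` into `𝔠` cells that each meet all of them
(`exists_forall_cantor_surjective`). A cell meager in an open set `U` would miss the trace on `U` of
some dense `Gδ` set, but under the present hypotheses that trace contains a Cantor set. Since there
are at most `𝔠` formulas, merging cells suits every `J`. -/

namespace BaireLogic

open Formula

/-! ## Soundness of `S5` for Baire algebras -/

section Soundness

variable {B : Type*} [ClosureAlgebra B] {P : Type*}

theorem Formula.val_or (v : P → B) (φ ψ : Formula P) :
    val v (or φ ψ) = val v φ ⊔ val v ψ := by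
  simp [Formula.or, val, compl_inf]

theorem Formula.val_imp_eq_top (v : P → B) (φ ψ : Formula P) :
    val v (imp φ ψ) = ⊤ ↔ val v φ ≤ val v ψ := by
  simp only [Formula.imp, val, compl_eq_top]
  rw [← disjoint_iff, disjoint_compl_right_iff]

theorem Formula.val_subst (v : P → B) (σ : P → Formula P) (φ : Formula P) :
    val v (subst σ φ) = val (fun p => val v (σ p)) φ := by
  induction φ with
  | var p => rfl
  | and φ ψ hφ hψ => simp only [subst, val, hφ, hψ]
  | neg φ hφ => simp only [subst, val, hφ]
  | dia φ hφ => simp only [subst, val, hφ]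

theorem ClosureAlgebra.c_mono {a b : B} (h : a ≤ b) : c a ≤ c b := by
  rw [← sup_eq_right.2 h, c_sup]
  exact le_sup_left

end Soundness

section BaireSoundness

variable {X : Type*} [TopologicalSpace X] {P : Type*}

/-- A choice of representatives of the values of formulas that commutes with the Boolean
operations. -/
noncomputable def Formula.rep (v : P → BaireAlgebra X) : Formula P → Set X
  | var p => Quotient.out (s := meagerSetoid X) (v p)
  | and φ ψ => rep v φ ∩ rep v ψ
  | neg φ => (rep v φ)ᶜ
  | dia φ => Quotient.out (s := meagerSetoid X) (val v (dia φ) : BaireAlgebra X)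

theorem Formula.mk_rep (v : P → BaireAlgebra X) (φ : Formula P) :
    BaireAlgebra.mk (rep v φ) = val v φ := by
  induction φ with
  | var p => exact Quotient.out_eq (s := meagerSetoid X) _
  | and φ ψ hφ hψ => rw [val, ← hφ, ← hψ]; rfl
  | neg φ hφ => rw [val, ← hφ]; rfl
  | dia φ => exact Quotient.out_eq (s := meagerSetoid X) _

/-- Representatives obey the Boolean clauses exactly, not just modulo meager sets, so membership of
a fixed point in them is a truth assignment. -/
theorem Formula.IsTautology.val_eq_top {φ : Formula P} (h : IsTautology φ)
    (v : P → BaireAlgebra X) : val v φ = ⊤ := by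
  have : rep v φ = univ := eq_univ_of_forall fun x =>
    h (fun ψ => x ∈ rep v ψ) (fun _ _ => Iff.rfl) (fun _ => Iff.rfl)
  rw [← mk_rep, this, BaireAlgebra.top_def]

/-- The complement of a closed element of a Baire algebra is closed. -/
theorem BaireAlgebra.IsClosedElem.compl {a : BaireAlgebra X} (h : a.IsClosedElem) :
    aᶜ.IsClosedElem := by
  obtain ⟨C, hC, rfl⟩ := h
  -- `closure Cᶜ` exceeds the open set `Cᶜ` only by the frontier of `C`, which is nowhere dense.
  refine ⟨closure Cᶜ, isClosed_closure, ?_⟩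
  rw [compl_mk, mk_eq_mk]
  constructor
  · rw [sdiff_eq_empty.2 subset_closure]
    exact IsMeagre.empty
  · rw [← hC.isOpen_compl.frontier_eq, frontier_compl]
    refine IsNowhereDense.isMeagre ?_
    rw [isClosed_frontier.isNowhereDense_iff]
    exact interior_frontier hC

theorem BaireAlgebra.IsClosedElem.c_eq {a : BaireAlgebra X} (h : a.IsClosedElem) :
    ClosureAlgebra.c a = a :=
  le_antisymm (a.isLeast_cl.2 ⟨h, le_rfl⟩) (ClosureAlgebra.le_c a)

theorem S5Theorem.val_eq_top {φ : Formula P} (h : S5Theorem φ) (v : P → BaireAlgebra X) :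
    val v φ = ⊤ := by
  -- The substitution rule changes the valuation, so `v` has to vary in the induction.
  induction h generalizing v with
  | taut h => exact h.val_eq_top v
  | axM φ ψ =>
    rw [val_imp_eq_top, val_or]
    simp only [val, val_or]
    exact (ClosureAlgebra.c_sup _ _).le
  | axT φ => exact (val_imp_eq_top _ _ _).2 (ClosureAlgebra.le_c _)
  | ax4 φ => exact (val_imp_eq_top _ _ _).2 (ClosureAlgebra.c_c_le _)
  | axN φ => simp [val, ClosureAlgebra.c_bot]
  | ax5 φ =>
    rw [val_imp_eq_top]
    simp only [Formula.box, val]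
    have h : (ClosureAlgebra.c (val v φ)).IsClosedElem := (BaireAlgebra.isLeast_cl (val v φ)).1.1
    rw [h.compl.c_eq, compl_compl]
  | sub σ _ ih => rw [val_subst]; exact ih _
  | mp _ _ h₁ h₂ =>
    have := (val_imp_eq_top _ _ _).1 (h₂ v)
    rwa [h₁ v, top_le_iff] at this
  | mon _ ih =>
    rw [val_imp_eq_top]
    exact ClosureAlgebra.c_mono ((val_imp_eq_top _ _ _).1 (ih v))

variable (X P) in
theorem sound_S5 : Sound (S5 P) (BaireAlgebra X) := fun _ h v => S5Theorem.val_eq_top h v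

end BaireSoundness

/-! ## Canonical models -/

section Canonical

variable {P : Type*}

/-- Truth assignments to formulas which respect the Boolean connectives. -/
structure Formula.IsAssignment (t : Formula P → Prop) : Prop where
  and : ∀ ψ χ, t (and ψ χ) ↔ t ψ ∧ t χ
  neg : ∀ ψ, t (neg ψ) ↔ ¬ t ψ

theorem Formula.isTautology_of {φ : Formula P} (h : ∀ t, IsAssignment t → t φ) :
    IsTautology φ := fun t h₁ h₂ => h t ⟨h₁, h₂⟩

theorem Formula.IsAssignment.imp {t : Formula P → Prop} (h : IsAssignment t) (φ ψ : Formula P) :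
    t (imp φ ψ) ↔ (t φ → t ψ) := by
  simp [Formula.imp, h.and, h.neg]

theorem Formula.IsAssignment.or {t : Formula P → Prop} (h : IsAssignment t) (φ ψ : Formula P) :
    t (or φ ψ) ↔ t φ ∨ t ψ := by
  simp only [Formula.or, h.and, h.neg]; tauto

theorem Formula.IsTautology.apply {t : Formula P → Prop} (h : IsAssignment t) {φ : Formula P}
    (hφ : IsTautology φ) : t φ := hφ t h.and h.neg

/-- Sets of formulas containing the tautologies and closed under modus ponens. -/
structure IsTheory (D : Set (Formula P)) : Prop where
  taut : ∀ {φ}, IsTautology φ → φ ∈ D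
  mp : ∀ {φ ψ}, φ ∈ D → imp φ ψ ∈ D → ψ ∈ D

/-- Lindenbaum's lemma. -/
theorem IsTheory.exists_assignment {D : Set (Formula P)} (hD : IsTheory D) {χ : Formula P}
    (hχ : χ ∉ D) : ∃ t, IsAssignment t ∧ (∀ ψ ∈ D, t ψ) ∧ ¬ t χ := by
  obtain ⟨M, hDM, hM⟩ := zorn_subset_nonempty {E : Set (Formula P) | IsTheory E ∧ χ ∉ E} (by
    intro c hc hchain hne
    refine ⟨⋃₀ c, ⟨⟨fun hφ => ?_, ?_⟩, ?_⟩, fun s hs => subset_sUnion_of_mem hs⟩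
    · obtain ⟨E, hE⟩ := hne
      exact ⟨E, hE, (hc hE).1.taut hφ⟩
    · rintro φ ψ ⟨E, hE, hφ⟩ ⟨F, hF, hi⟩
      rcases hchain.total hE hF with h | h
      · exact ⟨F, hF, (hc hF).1.mp (h hφ) hi⟩
      · exact ⟨E, hE, (hc hE).1.mp hφ (h hi)⟩
    · rintro ⟨E, hE, h⟩
      exact (hc hE).2 h) D ⟨hD, hχ⟩
  have hT := hM.prop.1
  have hχM := hM.prop.2
  have mp₁ : ∀ {α β}, α ∈ M → (∀ t, IsAssignment t → t α → t β) → β ∈ M := fun hα h =>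
    hT.mp hα (hT.taut (isTautology_of fun t ht => (ht.imp _ _).2 (h t ht)))
  have mp₂ : ∀ {α β γ}, α ∈ M → β ∈ M → (∀ t, IsAssignment t → t α → t β → t γ) → γ ∈ M :=
    fun {α β γ} hα hβ h =>
    hT.mp hβ (mp₁ hα fun t ht a => (ht.imp _ _).2 (h t ht a))
  -- The `θ` with `imp ψ θ ∈ M` form a theory that contains `M` and `ψ`; by maximality of `M` it
  -- cannot omit `χ`.
  have key : ∀ ψ, ψ ∉ M → imp ψ χ ∈ M := by
    intro ψ hψ
    by_contra hcon
    have hE : {θ | imp ψ θ ∈ M} ∈ {E : Set (Formula P) | IsTheory E ∧ χ ∉ E} := by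
      refine ⟨⟨fun hφ => ?_, fun h₁ h₂ => ?_⟩, hcon⟩
      · exact hT.taut (isTautology_of fun t ht => (ht.imp _ _).2 fun _ => hφ.apply ht)
      · refine mp₂ h₁ h₂ fun t ht => ?_
        simp only [ht.imp]
        tauto
    refine hψ (hM.le_of_ge hE (fun θ hθ => ?_) ?_)
    · exact mp₁ hθ fun t ht h => (ht.imp _ _).2 fun _ => h
    · exact hT.taut (isTautology_of fun t ht => (ht.imp _ _).2 id)
  refine ⟨fun ψ => ψ ∈ M, ⟨fun ψ θ => ⟨fun h => ⟨?_, ?_⟩, fun h => ?_⟩, fun ψ => ⟨fun h h' => ?_,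
    fun h => ?_⟩⟩, fun ψ hψ => hDM hψ, hχM⟩
  · exact mp₁ h fun t ht h => ((ht.and _ _).1 h).1
  · exact mp₁ h fun t ht h => ((ht.and _ _).1 h).2
  · exact mp₂ h.1 h.2 fun t ht h₁ h₂ => (ht.and _ _).2 ⟨h₁, h₂⟩
  · exact hχM (mp₂ h h' fun t ht h₁ h₂ => absurd h₂ ((ht.neg _).1 h₁))
  · by_contra h'
    refine hχM (mp₂ (key _ h) (key _ h') fun t ht => ?_)
    simp only [ht.imp, ht.neg]
    tauto

variable {Γ : Set (Formula P)}

theorem Derivable.isTheory : IsTheory {φ | Derivable (S5 P) Γ φ} :=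
  ⟨fun h => .thm (.taut h), fun h₁ h₂ => .mp h₁ h₂⟩

/-- A world of the canonical model of `S5` over the premises `Γ`. -/
structure IsWorld (Γ : Set (Formula P)) (t : Formula P → Prop) : Prop extends IsAssignment t where
  derivable : ∀ {φ}, Derivable (S5 P) Γ φ → t φ

namespace IsWorld

variable {t : Formula P → Prop} (ht : IsWorld Γ t)

include ht

theorem dia_mono {φ ψ : Formula P} (h : Derivable (S5 P) Γ (Formula.imp φ ψ)) (hφ : t (dia φ)) :
    t (dia ψ) := (ht.imp _ _).1 (ht.derivable (.mon h)) hφ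

theorem dia_mono_taut {φ ψ : Formula P} (h : ∀ s, IsAssignment s → s φ → s ψ) (hφ : t (dia φ)) :
    t (dia ψ) :=
  ht.dia_mono (.thm (.taut (isTautology_of fun s hs => (hs.imp _ _).2 (h s hs)))) hφ

theorem dia_self {φ : Formula P} (h : t φ) : t (dia φ) :=
  (ht.imp _ _).1 (ht.derivable (.thm (.axT φ))) h

theorem dia_dia {φ : Formula P} (h : t (dia (dia φ))) : t (dia φ) :=
  (ht.imp _ _).1 (ht.derivable (.thm (.ax4 φ))) h

theorem dia_or {φ ψ : Formula P} (h : t (dia (Formula.or φ ψ))) : t (dia φ) ∨ t (dia ψ) :=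
  (ht.or _ _).1 ((ht.imp _ _).1 (ht.derivable (.thm (.axM φ ψ))) h)

theorem not_dia_neg_dia {φ : Formula P} (h : t (dia φ)) :
    ¬ t (dia (Formula.neg (dia φ))) := by
  have := (ht.imp _ _).1 (ht.derivable (.thm (.ax5 φ))) h
  exact (ht.neg _).1 this

/-- A refutable `φ` derivably implies `φ ∧ ¬φ`, so (Mon) reduces the claim to the axiom `¬◇(φ ∧
¬φ)`. -/
theorem not_dia_of_refutable {φ : Formula P} (h : Derivable (S5 P) Γ (Formula.neg φ)) :
    ¬ t (dia φ) := by
  intro hφ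
  refine (ht.neg _).1 (ht.derivable (.thm (.axN φ))) (ht.dia_mono (.mp h (.thm (.taut ?_))) hφ)
  refine isTautology_of fun s hs => ?_
  simp only [hs.imp, hs.and, hs.neg]
  tauto

/-- The existence lemma for the canonical model of `S5`. -/
theorem exists_world {ψ : Formula P} (hψ : t (dia ψ)) :
    ∃ s, IsWorld Γ s ∧ s ψ ∧ ∀ χ, s (dia χ) ↔ t (dia χ) := by
  -- This set consists of the `θ` for which `□(ψ → θ)` holds at `t`. An assignment extending it and
  -- refuting `¬ψ` is the required world.
  have hD : IsTheory {θ | ¬ t (dia (Formula.and ψ (Formula.neg θ)))} := by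
    refine ⟨fun {φ} hφ => ht.not_dia_of_refutable (.thm (.taut (isTautology_of fun s hs => ?_))),
      fun {α β} h₁ h₂ h => ?_⟩
    · simp only [hs.and, hs.neg]
      have := hφ.apply hs
      tauto
    · refine (ht.dia_or (ht.dia_mono_taut (fun s hs => ?_) h)).elim h₁ h₂
      simp only [hs.and, hs.neg, hs.or, hs.imp]
      tauto
  have hbot : Formula.neg ψ ∉ {θ | ¬ t (dia (Formula.and ψ (Formula.neg θ)))} := by
    intro h
    refine h (ht.dia_mono_taut (fun s hs => ?_) hψ)
    simp only [hs.and, hs.neg]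
    tauto
  obtain ⟨s, hs, hsD, hsψ⟩ := hD.exists_assignment hbot
  refine ⟨s, ⟨hs, fun {φ} hφ => hsD _ (ht.not_dia_of_refutable ?_)⟩, ?_, fun χ => ⟨fun h => ?_,
    fun h => hsD _ fun h' => ?_⟩⟩
  · refine .mp hφ (.thm (.taut (isTautology_of fun s hs => ?_)))
    simp only [hs.imp, hs.and, hs.neg]
    tauto
  · by_contra h
    exact hsψ ((hs.neg _).2 h)
  · by_contra h'
    -- If `◇χ` fails at `t`, so does `◇◇χ`, which puts `¬◇χ` into the theory. The last bullet is
    -- dual and uses axiom 5.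
    refine (hs.neg _).1 (hsD (Formula.neg (dia χ)) fun h'' => h' (ht.dia_dia ?_)) h
    refine ht.dia_mono_taut (fun s hs => ?_) h''
    simp only [hs.and, hs.neg]
    tauto
  · exact ht.not_dia_neg_dia h (ht.dia_mono_taut (fun s hs h => ((hs.and _ _).1 h).2) h')

end IsWorld

theorem exists_world_of_not_derivable {φ : Formula P} (h : ¬ Derivable (S5 P) Γ φ) :
    ∃ t, IsWorld Γ t ∧ ¬ t φ := by
  obtain ⟨t, ht, hD, hφ⟩ := Derivable.isTheory.exists_assignment h
  exact ⟨t, ⟨ht, fun h => hD _ h⟩, hφ⟩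

end Canonical

/-! ## Completeness from a partition into everywhere nonmeager sets -/

section Completeness

variable {X : Type*} [TopologicalSpace X] {P : Type*}

/-- If `C` is a closed set representing the closure, then `A` is meager in the open set `Cᶜ`, which
must therefore be empty. -/
theorem BaireAlgebra.c_mk_eq_top {A : Set X}
    (hA : ∀ U : Set X, IsOpen U → U.Nonempty → ¬ IsMeagre (A ∩ U)) :
    ClosureAlgebra.c (BaireAlgebra.mk A) = ⊤ := by
  obtain ⟨⟨C, hC, hAC⟩, hle⟩ := (BaireAlgebra.mk A).isLeast_cl.1
  change BaireAlgebra.cl _ = _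
  rw [hAC, mk_le_mk] at hle
  have : Cᶜ = ∅ := not_nonempty_iff_eq_empty.1 fun hne => hA _ hC.isOpen_compl hne hle
  rw [hAC, compl_empty_iff.1 this, top_def]

/-- Strong completeness of `S5` for the Baire algebra of a space that can be mapped onto every set
of at most as many elements as there are formulas with everywhere nonmeager fibres. -/
theorem stronglyComplete_of_fibres [Nonempty X]
    (hX : ∀ J : Set (Formula P), J.Nonempty → ∃ f : X → J, ∀ (j : J) (U : Set X), IsOpen U →
      U.Nonempty → ¬ IsMeagre (f ⁻¹' {j} ∩ U)) :
    StronglyComplete (S5 P) (BaireAlgebra X) := by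
  intro Γ φ hcons
  by_contra hder
  obtain ⟨t, ht, hφ⟩ := exists_world_of_not_derivable hder
  have hnφ : t (dia (neg φ)) := ht.dia_self ((ht.neg _).2 hφ)
  -- Worlds are indexed by the formulas they witness, which bounds the number of fibres needed by
  -- the number of formulas.
  choose! w hw hwψ hwt using fun ψ (hψ : t (dia ψ)) => ht.exists_world hψ
  obtain ⟨f, hf⟩ := hX {ψ | t (dia ψ)} ⟨_, hnφ⟩
  let v : P → BaireAlgebra X := fun p => BaireAlgebra.mk {x | w (f x) (var p)}
  have hnm : ∀ θ, t (dia θ) → ∀ U : Set X, IsOpen U → U.Nonempty →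
      ¬ IsMeagre ({x | w (f x) θ} ∩ U) := by
    intro θ hθ U hU hne hm
    refine hf ⟨θ, hθ⟩ U hU hne (hm.mono (inter_subset_inter_left _ fun x hx => ?_))
    have : f x = ⟨θ, hθ⟩ := hx
    rw [mem_ofPred_eq, this]
    exact hwψ θ hθ
  have hval : ∀ θ, val v θ = BaireAlgebra.mk {x | w (f x) θ} := by
    intro θ
    induction θ with
    | var p => rfl
    | and α β hα hβ =>
      rw [val, hα, hβ, BaireAlgebra.mk_inf_mk]
      congr 1
      ext x
      exact ((hw _ (f x).2).and α β).symm
    | neg α hα =>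
      rw [val, hα, BaireAlgebra.compl_mk]
      congr 1
      ext x
      exact ((hw _ (f x).2).neg α).symm
    | dia α hα =>
      rw [val, hα]
      by_cases h : t (dia α)
      · rw [BaireAlgebra.c_mk_eq_top (hnm α h), BaireAlgebra.top_def]
        congr 1
        ext x
        exact ⟨fun _ => (hwt _ (f x).2 α).2 h, fun _ => trivial⟩
      · have h₁ : ∀ x, ¬ w (f x) (dia α) := fun x hx => h ((hwt _ (f x).2 α).1 hx)
        have h₂ : ∀ x, ¬ w (f x) α := fun x hx => h₁ x ((hw _ (f x).2).dia_self hx)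
        simp only [h₁, h₂, ofPred_false]
        rw [← BaireAlgebra.bot_def, ClosureAlgebra.c_bot]
  have hφv := hcons v fun γ hγ => by
    rw [hval, BaireAlgebra.top_def]
    congr 1
    exact eq_univ_of_forall fun x => (hw _ (f x).2).derivable (.prem hγ)
  rw [hval, BaireAlgebra.top_def, BaireAlgebra.mk_eq_mk] at hφv
  refine hnm (neg φ) hnφ univ isOpen_univ univ_nonempty (hφv.2.mono ?_)
  rintro x ⟨hx, -⟩
  exact ⟨trivial, ((hw _ (f x).2).neg φ).1 hx⟩

theorem Derivable.s5Theorem {φ : Formula P} (h : Derivable (S5 P) ∅ φ) : S5Theorem φ := by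
  induction h with
  | prem h => exact h.elim
  | thm h => exact h
  | mp _ _ h₁ h₂ => exact .mp h₁ h₂
  | mon _ h => exact .mon h

theorem log_eq_of_stronglyComplete (h : StronglyComplete (S5 P) (BaireAlgebra X)) :
    Log P (BaireAlgebra X) = S5 P :=
  Subset.antisymm (fun φ hφ => (h ∅ φ fun v _ => hφ v).s5Theorem) (sound_S5 X P)

/-- There are at most continuum many formulas over at most continuum many variables. -/
theorem Formula.mk_le_continuum {P : Type*} (h : Cardinal.mk P ≤ Cardinal.continuum) :
    Cardinal.mk (Formula P) ≤ Cardinal.continuum := by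
  -- Polish notation. Unique readability is proved with arbitrary tails `l`, `m`, so that the
  -- induction passes through the concatenation in `and`.
  let enc : Formula P → List (P ⊕ Fin 3) := fun φ => φ.rec (fun p => [Sum.inl p])
    (fun _ _ a b => Sum.inr 0 :: (a ++ b)) (fun _ a => Sum.inr 1 :: a) (fun _ a => Sum.inr 2 :: a)
  have henc : ∀ φ ψ (l m : List (P ⊕ Fin 3)), enc φ ++ l = enc ψ ++ m → φ = ψ ∧ l = m := by
    intro φ
    induction φ with
    | var p => rintro (q | _ | _ | _) l m h <;> simp_all [enc]
    | and α β hα hβ =>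
      rintro (q | ⟨γ, δ⟩ | _ | _) l m h
      · simp [enc] at h
      · have h' : enc α ++ (enc β ++ l) = enc γ ++ (enc δ ++ m) := by simpa [enc] using h
        obtain ⟨rfl, h''⟩ := hα _ _ _ h'
        obtain ⟨rfl, rfl⟩ := hβ _ _ _ h''
        exact ⟨rfl, rfl⟩
      · simp [enc] at h
      · simp [enc] at h
    | neg α hα =>
      rintro (q | _ | γ | _) l m h
      · simp [enc] at h
      · simp [enc] at h
      · have h' : enc α ++ l = enc γ ++ m := by simpa [enc] using h
        obtain ⟨rfl, rfl⟩ := hα _ _ _ h'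
        exact ⟨rfl, rfl⟩
      · simp [enc] at h
    | dia α hα =>
      rintro (q | _ | _ | γ) l m h
      · simp [enc] at h
      · simp [enc] at h
      · simp [enc] at h
      · have h' : enc α ++ l = enc γ ++ m := by simpa [enc] using h
        obtain ⟨rfl, rfl⟩ := hα _ _ _ h'
        exact ⟨rfl, rfl⟩
  have hinj : Function.Injective enc := fun φ ψ h => (henc φ ψ [] [] (by rw [h])).1
  refine (Cardinal.mk_le_of_injective hinj).trans ((Cardinal.mk_list_le_max _).trans
    (max_le Cardinal.aleph0_le_continuum ?_))
  rw [Cardinal.mk_sum]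
  refine Cardinal.add_le_of_le Cardinal.aleph0_le_continuum (by simpa using h) ?_
  simpa using (Cardinal.nat_lt_continuum 3).le

end Completeness

end BaireLogic

/-! ## Cantor sets and everywhere nonmeager partitions -/

universe u

open Cardinal in
/-- A family of large sets has an injective choice function. -/
theorem exists_injective_forall_mem {ι X : Type u} (K : ι → Set X) (hK : ∀ i, #ι ≤ #(K i)) :
    ∃ g : ι → X, Function.Injective g ∧ ∀ i, g i ∈ K i := by
  -- In a well-order of least possible type each index has fewer than `#ι` predecessors, so earlier
  -- choices cannot exhaust `K i`.
  obtain ⟨_, _, hι⟩ := exists_ord_eq_type_lt ι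
  have hex : ∀ (i : ι) (g : ∀ j, j < i → X), ∃ y ∈ K i, ∀ j (hj : j < i), g j hj ≠ y := by
    intro i g
    by_contra! hcon
    have hsub : K i ⊆ range fun j : Iio i => g j.1 j.2 := fun y hy =>
      let ⟨j, hj, h⟩ := hcon y hy
      ⟨⟨j, hj⟩, h⟩
    exact ((hK i).trans ((mk_le_mk_of_subset hsub).trans mk_range_le)).not_gt (mk_Iio_lt i hι)
  choose F hFK hF using hex
  let g : ι → X := wellFounded_lt.fix F
  have hg : ∀ i, g i = F i fun j _ => g j := fun i => wellFounded_lt.fix_eq F i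
  have hlt : ∀ i j, j < i → g j ≠ g i := by
    intro i j hj
    rw [hg i]
    exact hF i (fun k _ => g k) j hj
  refine ⟨g, fun i j h => ?_, fun i => by rw [hg i]; exact hFK i _⟩
  rcases lt_trichotomy i j with hij | hij | hij
  · exact absurd h (hlt _ _ hij)
  · exact hij
  · exact absurd h.symm (hlt _ _ hij)

open Cardinal in
/-- A partition into continuum many Bernstein sets. -/
theorem exists_forall_cantor_surjective {X : Type u} [TopologicalSpace X] [T2Space X]
    (hX : #X ≤ 𝔠) :
    ∃ f : X → (ℕ → Bool), ∀ g : (ℕ → Bool) → X, Continuous g → Function.Injective g →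
      Function.Surjective (f ∘ g) := by
  let ι := {g : (ℕ → Bool) → X // Continuous g ∧ Function.Injective g}
  have hι : #ι ≤ 𝔠 := by
    -- A continuous map into a Hausdorff space is determined by its values on a dense sequence; this
    -- gives at most `𝔠 ^ ℵ₀ = 𝔠` maps.
    have hinj : Function.Injective
        fun (g : ι) (n : ℕ) => g.1 (TopologicalSpace.denseSeq (ℕ → Bool) n) := by
      intro g h hgh
      refine Subtype.ext ((TopologicalSpace.denseRange_denseSeq _).equalizer g.2.1 h.2.1 ?_)
      exact hgh
    refine (mk_le_of_injective hinj).trans ?_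
    rw [mk_arrow, mk_nat, lift_aleph0, lift_uzero]
    exact (power_le_power_right hX).trans continuum_power_aleph0.le
  have hc : #(ℕ → Bool) = 𝔠 := by simp
  obtain ⟨h, hinj, hh⟩ := exists_injective_forall_mem (fun i : ι × (ℕ → Bool) => range i.1.1)
    (by
      rintro ⟨⟨g, hg⟩, j⟩
      have h₁ : #(range g) = 𝔠 := by
        have := mk_range_eq_of_injective hg.2
        simpa using this
      rw [h₁, mk_prod, hc, lift_continuum, lift_uzero]
      exact mul_le_of_le aleph0_le_continuum hι le_rfl)
  -- The point chosen in the range of `g` for the pair `(g, j)` is sent to `j`; points never chosen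
  -- go to the constant sequence `false`.
  refine ⟨fun x => (Function.partialInv h x).elim (fun _ => false) Prod.snd, fun g hg hgi j => ?_⟩
  obtain ⟨y, hy⟩ := hh (⟨g, hg, hgi⟩, j)
  refine ⟨y, ?_⟩
  simp only [Function.comp_apply]
  rw [show g y = h _ from hy, Function.partialInv_left hinj]
  rfl

/-! ### Complete metrizability of `Gδ` sets, and Cantor sets inside dense `Gδ` sets -/

theorem IsOpen.isCompletelyMetrizableSpace {X : Type*} [TopologicalSpace X]
    [TopologicalSpace.IsCompletelyMetrizableSpace X] {s : Set X} (hs : IsOpen s) :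
    TopologicalSpace.IsCompletelyMetrizableSpace s := by
  let := TopologicalSpace.upgradeIsCompletelyMetrizable X
  lift s to TopologicalSpace.Opens X using hs
  exact inferInstanceAs (TopologicalSpace.IsCompletelyMetrizableSpace s.CompleteCopy)

/-- A `Gδ` subset of a completely metrizable space is completely metrizable. -/
theorem IsGδ.isCompletelyMetrizableSpace {X : Type*} [TopologicalSpace X]
    [TopologicalSpace.IsCompletelyMetrizableSpace X] {s : Set X} (hs : IsGδ s) :
    TopologicalSpace.IsCompletelyMetrizableSpace s := by
  obtain ⟨V, hV, rfl⟩ := isGδ_iff_eq_iInter_nat.1 hs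
  have := fun n => (hV n).isCompletelyMetrizableSpace
  -- The diagonal identifies the intersection with a closed subset of a countable product of
  -- completely metrizable spaces.
  let d : ↥(⋂ n, V n) → ∀ n, V n := fun x n => ⟨x, mem_iInter.1 x.2 n⟩
  have hd : Continuous d := by fun_prop
  have hemb : IsEmbedding d := by
    refine IsEmbedding.of_comp hd (g := fun y => (y 0 : X)) (by fun_prop) ?_
    exact IsEmbedding.subtypeVal
  refine IsClosedEmbedding.IsCompletelyMetrizableSpace (f := d) ⟨hemb, ?_⟩
  have hr : range d = ⋂ n, {y : ∀ n, V n | (y n : X) = y 0} := by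
    ext y
    simp only [mem_range, mem_iInter, mem_ofPred_eq]
    constructor
    · rintro ⟨x, rfl⟩ n
      rfl
    · intro h
      exact ⟨⟨y 0, mem_iInter.2 fun n => h n ▸ (y n).2⟩, funext fun n => Subtype.ext (h n).symm⟩
  rw [hr]
  exact isClosed_iInter fun n => isClosed_eq (by fun_prop) (by fun_prop)

theorem Topology.IsEmbedding.perfectSpace {X Y : Type*} [TopologicalSpace X] [TopologicalSpace Y]
    {f : X → Y} (hf : IsEmbedding f) (h : Preperfect (range f)) : PerfectSpace X := by
  refine ⟨preperfect_iff_nhds.2 fun x _ U hU => ?_⟩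
  rw [hf.nhds_eq_comap] at hU
  obtain ⟨V, hV, hVU⟩ := hU
  obtain ⟨_, ⟨hyV, y, rfl⟩, hne⟩ := preperfect_iff_nhds.1 h (f x) (mem_range_self x) V hV
  exact ⟨y, ⟨hVU hyV, trivial⟩, fun h => hne (h ▸ rfl)⟩

/-- In a perfect T1 space, the trace of a dense set on an open set is
preperfect. -/
theorem Dense.preperfect_inter_of_isOpen {X : Type*} [TopologicalSpace X] [PerfectSpace X]
    [T1Space X] {t U : Set X} (ht : Dense t) (hU : IsOpen U) :
    Preperfect (t ∩ U) := by
  refine preperfect_iff_nhds.2 fun x hx V hV => ?_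
  obtain ⟨W, hWV, hW, hxW⟩ := mem_nhds_iff.1 hV
  obtain ⟨y, hy, hyx⟩ := preperfect_iff_nhds.1 (PerfectSpace.univ_preperfect (α := X)) x trivial
    (W ∩ U) ((hW.inter hU).mem_nhds ⟨hxW, hx.2⟩)
  -- The point `y` serves only to show that this open set, from which `x` is removed, is nonempty.
  obtain ⟨z, ⟨⟨hzW, hzU⟩, hzx⟩, hzt⟩ := ht.inter_open_nonempty ((W ∩ U) ∩ {x}ᶜ)
    ((hW.inter hU).inter isOpen_compl_singleton) ⟨y, hy.1, hyx⟩
  exact ⟨z, ⟨hWV hzW, hzt, hzU⟩, hzx⟩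

/-- In a perfect Baire space which is locally completely metrizable, a dense `Gδ` set contains a
Cantor set in each nonempty open set. -/
theorem IsGδ.exists_cantor_subset {X : Type*} [TopologicalSpace X] [PerfectSpace X]
    [T1Space X] [BaireSpace X]
    (hX : ∀ x : X, ∃ K ∈ 𝓝 x, TopologicalSpace.IsCompletelyMetrizableSpace K)
    {t U : Set X} (htδ : IsGδ t) (ht : Dense t) (hU : IsOpen U) (hne : U.Nonempty) :
    ∃ g : (ℕ → Bool) → X, Continuous g ∧ Function.Injective g ∧ range g ⊆ t ∩ U := by
  obtain ⟨x, hx⟩ := hne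
  obtain ⟨K, hK, hKm⟩ := hX x
  have hU' : IsOpen (U ∩ interior K) := hU.inter isOpen_interior
  have hS : Preperfect (t ∩ (U ∩ interior K)) := ht.preperfect_inter_of_isOpen hU'
  have hSδ : IsGδ (t ∩ (U ∩ interior K)) := htδ.inter hU'.isGδ
  obtain ⟨y, hyU, hyt⟩ := ht.inter_open_nonempty _ hU' ⟨x, hx, mem_interior_iff_mem_nhds.2 hK⟩
  -- Viewed inside `K`, the trace is a `Gδ` set in a completely metrizable space; nothing is lost,
  -- as it lies in `interior K`.
  let T : Set K := Subtype.val ⁻¹' (t ∩ (U ∩ interior K))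
  have hTm : TopologicalSpace.IsCompletelyMetrizableSpace T :=
    (hSδ.preimage continuous_subtype_val).isCompletelyMetrizableSpace
  have hemb : IsEmbedding fun z : T => (z : X) := IsEmbedding.subtypeVal.comp .subtypeVal
  have hr : range (fun z : T => (z : X)) = t ∩ (U ∩ interior K) := by
    ext z
    constructor
    · rintro ⟨z, rfl⟩
      exact z.2
    · intro hz
      exact ⟨⟨⟨z, interior_subset hz.2.2⟩, hz⟩, rfl⟩
  have hTp : PerfectSpace T := hemb.perfectSpace (hr ▸ hS)
  have hTn : Nonempty T := ⟨⟨⟨y, interior_subset hyU.2⟩, hyt, hyU⟩⟩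
  let := TopologicalSpace.upgradeIsCompletelyMetrizable T
  obtain ⟨g, -, hgc, hgi⟩ :=
    (PerfectSpace.univ_perfect T).exists_nat_bool_injection univ_nonempty
  refine ⟨fun z => ((g z : T) : X), hemb.continuous.comp hgc, hemb.injective.comp hgi, ?_⟩
  rintro _ ⟨z, rfl⟩
  exact ⟨(g z).2.1, (g z).2.2.1⟩

open Cardinal in
/-- A perfect Baire space of size at most the continuum which is locally completely metrizable has
a partition into continuum many everywhere nonmeager sets. -/
theorem exists_forall_not_isMeagre_fibre {X : Type*} [TopologicalSpace X] [PerfectSpace X]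
    [T2Space X] [BaireSpace X]
    (hX : ∀ x : X, ∃ K ∈ 𝓝 x, TopologicalSpace.IsCompletelyMetrizableSpace K) (hc : #X ≤ 𝔠) :
    ∃ f : X → (ℕ → Bool), ∀ (j : ℕ → Bool) (U : Set X), IsOpen U → U.Nonempty →
      ¬ IsMeagre (f ⁻¹' {j} ∩ U) := by
  obtain ⟨f, hf⟩ := exists_forall_cantor_surjective hc
  refine ⟨f, fun j U hU hne hm => ?_⟩
  -- The Baire property supplies a dense `Gδ` set `t` disjoint from the part of the fibre in `U`.
  obtain ⟨t, hts, htδ, htd⟩ := mem_residual.1 hm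
  obtain ⟨g, hgc, hgi, hgr⟩ := htδ.exists_cantor_subset hX htd hU hne
  obtain ⟨z, hz⟩ := hf g hgc hgi j
  have hgz := hgr (mem_range_self z)
  exact hts hgz.1 ⟨hz, hgz.2⟩

open Cardinal in
theorem Cardinal.mk_le_continuum_of_secondCountableTopology (X : Type*) [TopologicalSpace X]
    [T0Space X] [SecondCountableTopology X] : #X ≤ 𝔠 := by
  obtain ⟨b, hb, -, hbasis⟩ := TopologicalSpace.exists_countable_basis X
  have hinj : Function.Injective fun x : X => {s : b | x ∈ (s : Set X)} := by
    intro x y h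
    refine hbasis.eq_iff.2 fun s hs => ?_
    exact Set.ext_iff.1 h ⟨s, hs⟩
  refine (mk_le_of_injective hinj).trans ?_
  rw [mk_set, ← two_power_aleph0]
  exact power_le_power_left two_ne_zero (mk_le_aleph0_iff.2 hb.to_subtype)

/-! ## The theorem -/

theorem TopologicalSpace.IsCompletelyMetrizableSpace.of_compact_secondCountable (X : Type*) [TopologicalSpace X]
    [CompactSpace X] [T2Space X] [SecondCountableTopology X] :
    TopologicalSpace.IsCompletelyMetrizableSpace X := by
  let := TopologicalSpace.metrizableSpaceMetric X
  infer_instance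

theorem Perfect.perfectSpace {X : Type*} [TopologicalSpace X] {C : Set X} (hC : Perfect C) :
    PerfectSpace C :=
  IsEmbedding.subtypeVal.perfectSpace (by simpa using hC.acc)

theorem perfectSpace_cantor : PerfectSpace (ℕ → Bool) := by
  refine ⟨preperfect_iff_nhds.2 fun x _ U hU => ?_⟩
  -- Flipping the `n`-th coordinate gives points different from `x` that converge to `x`.
  have h : Filter.Tendsto (fun n => Function.update x n (!x n)) Filter.atTop (𝓝 x) := by
    refine tendsto_pi_nhds.2 fun i => tendsto_nhds_of_eventually_eq ?_
    filter_upwards [Filter.eventually_gt_atTop i] with n hn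
    exact Function.update_of_ne hn.ne _ _
  obtain ⟨n, hn⟩ := (h.eventually hU).exists
  refine ⟨_, ⟨hn, trivial⟩, fun h => ?_⟩
  have := congrFun h n
  simp at this

theorem lp.nontrivial (𝕜 : Type*) [RCLike 𝕜] (p : ENNReal) :
    Nontrivial (lp (fun _ : ℕ => 𝕜) p) := by
  refine ⟨lp.single p 0 (1 : 𝕜), 0, fun h => ?_⟩
  have := congrArg (fun f : lp (fun _ : ℕ => 𝕜) p => f 0) h
  simp at this

namespace BaireLogic

open Cardinal

/-! ### Strong completeness for the two classes of spaces, and the logic of `ℓ^p` -/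

section

variable {X : Type*} [TopologicalSpace X] [Nonempty X] [PerfectSpace X] {P : Type*}

theorem stronglyComplete_S5 [T2Space X] [BaireSpace X]
    (hX : ∀ x : X, ∃ K ∈ 𝓝 x, TopologicalSpace.IsCompletelyMetrizableSpace K) (hc : #X ≤ 𝔠)
    (hP : #P ≤ 𝔠) : StronglyComplete (S5 P) (BaireAlgebra X) := by
  refine stronglyComplete_of_fibres fun J hJ => ?_
  obtain ⟨f, hf⟩ := exists_forall_not_isMeagre_fibre hX hc
  have hJc : lift.{0} #J ≤ lift #(ℕ → Bool) := by
    simpa using (mk_set_le J).trans (Formula.mk_le_continuum hP)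
  obtain ⟨e⟩ := lift_mk_le'.1 hJc
  have := hJ.to_subtype
  -- Cells are merged along a left inverse of the injection `e : J → (ℕ → Bool)`; the new cell of
  -- `j` contains the old cell of `e j`.
  refine ⟨fun x => Function.invFun e (f x), fun j U hU hne hm => hf (e j) U hU hne (hm.mono ?_)⟩
  rintro x ⟨hx, hxU⟩
  refine ⟨?_, hxU⟩
  rw [mem_preimage, mem_singleton_iff] at hx ⊢
  rw [hx, Function.leftInverse_invFun e.injective]

theorem stronglyComplete_S5_of_isCompletelyMetrizableSpace
    [TopologicalSpace.IsCompletelyMetrizableSpace X] (hc : #X ≤ 𝔠) (hP : #P ≤ 𝔠) :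
    StronglyComplete (S5 P) (BaireAlgebra X) := by
  let := TopologicalSpace.upgradeIsCompletelyMetrizable X
  exact stronglyComplete_S5 (fun x => ⟨univ, Filter.univ_mem, inferInstance⟩) hc hP

theorem stronglyComplete_S5_of_locallyCompactSpace [SecondCountableTopology X]
    [LocallyCompactSpace X] [T2Space X] (hP : #P ≤ 𝔠) :
    StronglyComplete (S5 P) (BaireAlgebra X) := by
  refine stronglyComplete_S5 (fun x => ?_) (mk_le_continuum_of_secondCountableTopology X) hP
  obtain ⟨K, hK, hxK⟩ := exists_compact_mem_nhds x
  have := isCompact_iff_compactSpace.1 hK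
  exact ⟨K, hxK, .of_compact_secondCountable K⟩

theorem log_eq_S5_of_locallyCompactSpace [SecondCountableTopology X]
    [LocallyCompactSpace X] [T2Space X] : Log ℕ (BaireAlgebra X) = S5 ℕ :=
  log_eq_of_stronglyComplete
    (stronglyComplete_S5_of_locallyCompactSpace (mk_nat.le.trans aleph0_le_continuum))

end

/-- The completely metrizable case applies to every `p`, including the nonseparable `p = ∞`: there
are only `𝔠 ^ ℵ₀ = 𝔠` scalar sequences. -/
theorem log_lp_eq_S5 (𝕜 : Type*) [RCLike 𝕜] (p : ENNReal) [Fact (1 ≤ p)] :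
    Log ℕ (BaireAlgebra (lp (fun _ : ℕ => 𝕜) p)) = S5 ℕ := by
  have := lp.nontrivial 𝕜 p
  have := perfectSpace_of_module 𝕜 (lp (fun _ : ℕ => 𝕜) p)
  refine log_eq_of_stronglyComplete (stronglyComplete_S5_of_isCompletelyMetrizableSpace ?_
    (mk_nat.le.trans aleph0_le_continuum))
  have hinj : Function.Injective fun (f : lp (fun _ : ℕ => 𝕜) p) (n : ℕ) => f n :=
    fun f g h => lp.ext h
  refine (mk_le_of_injective hinj).trans ?_
  rw [mk_arrow, mk_nat, lift_aleph0, lift_uzero]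
  have : ProperSpace 𝕜 := inferInstance
  exact (power_le_power_right (mk_le_continuum_of_secondCountableTopology 𝕜)).trans
    continuum_power_aleph0.le

end BaireLogic

theorem mainTheorem4 :
    (∀ (X : Type*) [TopologicalSpace X] [Nonempty X] [PerfectSpace X],
      ((TopologicalSpace.IsCompletelyMetrizableSpace X ∧ Cardinal.mk X = Cardinal.continuum) ∨
        (SecondCountableTopology X ∧ LocallyCompactSpace X ∧ T2Space X)) →
      ∀ (P : Type*), Cardinal.mk P = Cardinal.continuum →
        BaireLogic.Sound (BaireLogic.S5 P) (BaireLogic.BaireAlgebra X) ∧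
        BaireLogic.StronglyComplete (BaireLogic.S5 P) (BaireLogic.BaireAlgebra X)) ∧
    (∀ n : ℕ, 1 ≤ n →
      BaireLogic.Log ℕ (BaireLogic.BaireAlgebra (EuclideanSpace ℝ (Fin n))) = BaireLogic.S5 ℕ) ∧
    (∀ (n : ℕ) (C : Set (EuclideanSpace ℝ (Fin n))), Perfect C → C.Nonempty →
      BaireLogic.Log ℕ (BaireLogic.BaireAlgebra C) = BaireLogic.S5 ℕ) ∧
    BaireLogic.Log ℕ (BaireLogic.BaireAlgebra (ℕ → Bool)) = BaireLogic.S5 ℕ ∧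
    BaireLogic.Log ℕ (BaireLogic.BaireAlgebra (Set.Icc (0 : ℝ) 1)) = BaireLogic.S5 ℕ ∧
    (∀ (𝕜 : Type*) [RCLike 𝕜] (p : ENNReal) [Fact (1 ≤ p)],
      BaireLogic.Log ℕ (BaireLogic.BaireAlgebra (lp (fun _ : ℕ => 𝕜) p)) = BaireLogic.S5 ℕ) := by
  refine ⟨fun X _ _ _ hX P hP => ⟨BaireLogic.sound_S5 X P, ?_⟩, fun n hn => ?_,
    fun n C hC hne => ?_, ?_, ?_, fun 𝕜 _ p _ => BaireLogic.log_lp_eq_S5 𝕜 p⟩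
  · rcases hX with ⟨_, hc⟩ | ⟨_, _, _⟩
    · exact BaireLogic.stronglyComplete_S5_of_isCompletelyMetrizableSpace hc.le hP.le
    · exact BaireLogic.stronglyComplete_S5_of_locallyCompactSpace hP.le
  · have : Nonempty (Fin n) := ⟨⟨0, hn⟩⟩
    have := perfectSpace_of_module ℝ (EuclideanSpace ℝ (Fin n))
    exact BaireLogic.log_eq_S5_of_locallyCompactSpace
  · have := hC.perfectSpace
    have := hne.to_subtype
    have := hC.closed.locallyCompactSpace
    exact BaireLogic.log_eq_S5_of_locallyCompactSpace
  · have := perfectSpace_cantor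
    exact BaireLogic.log_eq_S5_of_locallyCompactSpace
  · have : PerfectSpace (Icc (0 : ℝ) 1) := inferInstance
    exact BaireLogic.log_eq_S5_of_locallyCompactSpace
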